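/- For $h\ge 1$ let $\mathcal G_h$ be the graph with vertex set $\{0,1,2,\dots\}\times\{0,\dots,h-1\}$ in which two vertices are adjacent if and only if their Euclidean distance is $1$. A growing self-avoiding walk (GSAW) on $\mathcal G_h$ is a finite walk that visits no vertex twice and whose last vertex is trapped, that is, every neighbour in $\mathcal G_h$ of the last vertex lies on the walk. For a GSAW $W$, let $|W|$ be its number of edges and let $\|W\|$ be its displacement, the difference between the largest and the smallest $x$-coordinate of the vertices of $W$. Let $W_{(0,h-1)}(\mathcal G_h)$ be the set of all GSAWs on $\mathcal G_h$ that start at the top-left corner $(0,h-1)$. Theorem. For every $h\ge 1$, the generating function \[ f_h(x,y)=\sum_{W\in W_{(0,h-1)}(\mathcal G_h)} x^{|W|}y^{\|W\|}\in\mathbb Q[[x,y]] \] is rational: there are polynomials $P,Q\in\mathbb Q[x,y]$ with $Q(0,0)\neq 0$ such that $f_h=P/Q$ in $\mathbb Q[[x,y]]$. -/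

import Mathlib

noncomputable section

/-- The grid graph on a set `S` of integer points of the plane: two points of `S` are adjacent
when their Euclidean distance is `1`. -/
def gridGraph (S : Set (ℤ × ℤ)) : SimpleGraph S where
  Adj p q := (p.1.1 - q.1.1) ^ 2 + (p.1.2 - q.1.2) ^ 2 = 1
  symm := ⟨fun p q h => by
    rw [← neg_sub p.1.1, ← neg_sub p.1.2, neg_sq, neg_sq]; exact h⟩
  loopless := ⟨fun p h => by simp at h⟩

/-- The point set `ℕ × {0, …, h - 1}`, where `ℕ` contains `0`. -/
def stripSet (h : ℕ) : Set (ℤ × ℤ) := {p | 0 ≤ p.1 ∧ 0 ≤ p.2 ∧ p.2 < (h : ℤ)}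

/-- The half-infinite grid graph of height `h`. -/
abbrev stripGraph (h : ℕ) : SimpleGraph (stripSet h) := gridGraph (stripSet h)

/-- The top-left corner `(0, h - 1)` of the half-infinite strip of height `h ≥ 1`. -/
def topLeft (h : ℕ) (hh : 1 ≤ h) : stripSet h :=
  ⟨(0, (h : ℤ) - 1), by
    have h1 : (1 : ℤ) ≤ h := by exact_mod_cast hh
    refine ⟨le_refl _, ?_, ?_⟩ <;> dsimp only <;> omega⟩

/-- A growing self-avoiding walk on `G` that starts at `v`: a finite walk that visits no vertex
twice and whose last vertex is trapped, that is, has all its neighbours on the walk. -/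
structure GSAW {V : Type*} (G : SimpleGraph V) (v : V) where
  /-- the last vertex -/
  last : V
  /-- the underlying walk -/
  walk : G.Walk v last
  isPath : walk.IsPath
  trapped : ∀ w : V, G.Adj last w → w ∈ walk.support

namespace GSAW

/-- The length of a growing self-avoiding walk: its number of edges. -/
def length {V : Type*} {G : SimpleGraph V} {v : V} (W : GSAW G v) : ℕ := W.walk.length

/-- The (nonempty) finite set of the first coordinates of the vertices of a walk on a grid graph. -/
def xCoords {S : Set (ℤ × ℤ)} {v : S} (W : GSAW (gridGraph S) v) : Finset ℤ :=
  (W.walk.support.map fun p => p.1.1).toFinset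

theorem xCoords_nonempty {S : Set (ℤ × ℤ)} {v : S} (W : GSAW (gridGraph S) v) :
    W.xCoords.Nonempty :=
  ⟨v.1.1, List.mem_toFinset.2 (List.mem_map.2 ⟨v, W.walk.start_mem_support, rfl⟩)⟩

/-- The displacement: the difference between the largest and the smallest first coordinate of the
vertices of the walk. -/
def displacement {S : Set (ℤ × ℤ)} {v : S} (W : GSAW (gridGraph S) v) : ℤ :=
  W.xCoords.max' W.xCoords_nonempty - W.xCoords.min' W.xCoords_nonempty

end GSAW

/-- The set of growing self-avoiding walks on the grid graph on `S` that start at `v`, have `n`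
edges and displacement `k`. -/
def gsawSet (S : Set (ℤ × ℤ)) (v : S) (n k : ℕ) : Set (GSAW (gridGraph S) v) :=
  {W | W.length = n ∧ W.displacement = (k : ℤ)}

theorem gridGraph_getVert_mem {S : Set (ℤ × ℤ)} {u v : S} (p : (gridGraph S).Walk u v) (i : ℕ) :
    |(p.getVert i).1.1 - u.1.1| ≤ i ∧ |(p.getVert i).1.2 - u.1.2| ≤ i := by
  induction p generalizing i with
  | nil => simp
  | @cons a b c hab q ih =>
    cases i with
    | zero => simp
    | succ i =>
      have h1 := ih i
      have h2 : (a.1.1 - b.1.1) ^ 2 + (a.1.2 - b.1.2) ^ 2 = 1 := hab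
      have h3 : |a.1.1 - b.1.1| ≤ 1 := by
        rw [← sq_le_one_iff_abs_le_one]; nlinarith [sq_nonneg (a.1.2 - b.1.2)]
      have h4 : |a.1.2 - b.1.2| ≤ 1 := by
        rw [← sq_le_one_iff_abs_le_one]; nlinarith [sq_nonneg (a.1.1 - b.1.1)]
      simp only [SimpleGraph.Walk.getVert_cons_succ]
      push_cast
      rw [abs_le] at *
      rw [abs_le] at *
      omega

/-- There are only finitely many walks to count, so the cardinality below is a true count. -/
theorem gsawSet_finite (S : Set (ℤ × ℤ)) (v : S) (n k : ℕ) : (gsawSet S v n k).Finite := by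
  let B : Set (ℤ × ℤ) :=
    Set.Icc (v.1.1 - n) (v.1.1 + n) ×ˢ Set.Icc (v.1.2 - n) (v.1.2 + n)
  have hB : B.Finite := (Set.finite_Icc _ _).prod (Set.finite_Icc _ _)
  have hT : (Set.univ.pi fun _ : Fin (n + 1) => B).Finite := Set.Finite.pi fun _ => hB
  refine Set.Finite.of_finite_image
    (f := fun W (i : Fin (n + 1)) => (W.walk.getVert i).1) (hT.subset ?_) ?_
  · rintro _ ⟨W, -, rfl⟩ i -
    have h := gridGraph_getVert_mem W.walk i
    have hi : ((i : ℕ) : ℤ) ≤ n := by have := i.2; omega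
    simp only [abs_le] at h
    simp only [B, Set.mem_prod, Set.mem_Icc]
    omega
  · rintro ⟨a, p, hp, tp⟩ ⟨hpn, -⟩ ⟨b, q, hq, tq⟩ ⟨hqn, -⟩ hpq
    simp only [GSAW.length] at hpn hqn
    have key : ∀ i, i ≤ n → p.getVert i = q.getVert i := fun i hi =>
      Subtype.ext (congrFun hpq ⟨i, by omega⟩)
    have hab : a = b := by
      have h := key n le_rfl
      rwa [← hpn, p.getVert_length, hpn, ← hqn, q.getVert_length] at h
    subst hab
    have : p = q := SimpleGraph.Walk.ext_getVert_le_length (hpn.trans hqn.symm)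
      fun i hi => key i (hpn ▸ hi)
    subst this
    rfl

/-- The generating function `∑ x^|W| y^‖W‖` over all growing self-avoiding walks `W` on the grid
graph on `S` that start at `v`, as a formal power series in `x` (variable `0`) and `y`
(variable `1`). -/
def gsawSeries (S : Set (ℤ × ℤ)) (v : S) : MvPowerSeries (Fin 2) ℚ :=
  fun m => ((gsawSet S v (m 0) (m 1)).ncard : ℚ)

/-- The generating function `f_h` of the growing self-avoiding walks on the half-infinite strip of
height `h` that start in the top-left corner. -/
def stripSeries (h : ℕ) (hh : 1 ≤ h) : MvPowerSeries (Fin 2) ℚ :=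
  gsawSeries (stripSet h) (topLeft h hh)

/-- A formal power series is rational if it is the quotient `P / Q` of two polynomials, where
`Q` has nonzero constant term and hence is invertible as a power series. -/
def IsRationalSeries (f : MvPowerSeries (Fin 2) ℚ) : Prop :=
  ∃ P Q : MvPolynomial (Fin 2) ℚ, MvPolynomial.constantCoeff Q ≠ 0 ∧
    f = (P : MvPowerSeries (Fin 2) ℚ) * (Q : MvPowerSeries (Fin 2) ℚ)⁻¹

end

/-! The proof is a transfer-matrix argument. A walk is replaced by the list of its directed edges in
order of traversal. For each column one keeps the sublist of edges touching that column, in order,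
translated to column `0`. A letter consists of two adjacent columns, and a walk of displacement `k`
becomes a word of `k + 1` letters. Edge lists at a column are duplicate-free lists over a finite
set, so the alphabet is finite.

The decisive fact is that the resulting language is local (`SwapClosed`): if two walks show the same
letter, the left part of one and the right part of the other glue to a walk
(`IsTrappedPath.exists_glue`). No record of how strands connect across the cut is needed, since each
side knows the order in which the crossing edges are used. That order lets the two sides be
interleaved into a single chain (`exists_amalgam`). Self-avoidance and trapping involve only one
column or two adjacent ones, so they survive the gluing.

In a local language the possible continuations depend only on the last letter. The generating
functions of the continuations therefore satisfy a finite linear system `g = v + M g` whose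
coefficients have no constant term, and Cramer's rule gives rationality
(`isRationalSeries_of_swapClosed`). The dictionary between walks and words is `ncard_gsawSet_eq`. -/

/-! ### Local languages and their first-letter recursion -/

section Words

variable {σ : Type*}

/-- The words `v` such that some word `u ++ a :: v` belongs to the language `L`. -/
def rightContexts (L : Set (List σ)) (a : σ) : Set (List σ) := {v | ∃ u, u ++ a :: v ∈ L}

/-- A language in which two words may be cut at a common letter and glued crosswise. -/
def SwapClosed (L : Set (List σ)) : Prop :=
  ∀ u v u' v' a, u ++ a :: v ∈ L → u' ++ a :: v' ∈ L → u ++ a :: v' ∈ L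

/-- The words of `L` of length `k` and total weight `n`. -/
def wordsOfWeight (L : Set (List σ)) (w : σ → ℕ) (n k : ℕ) : Set (List σ) :=
  {v | v ∈ L ∧ v.length = k ∧ (v.map w).sum = n}

/-- The generating function of a language by weight and length. -/
noncomputable def wordSeries (L : Set (List σ)) (w : σ → ℕ) : MvPowerSeries (Fin 2) ℚ :=
  fun m => ((wordsOfWeight L w (m 0) (m 1)).ncard : ℚ)

theorem finite_wordsOfWeight {L : Set (List σ)} {T : Finset σ} (hT : ∀ l ∈ L, ∀ a ∈ l, a ∈ T)
    (w : σ → ℕ) (n k : ℕ) : (wordsOfWeight L w n k).Finite := by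
  refine ((List.finite_length_eq T k).image (List.map Subtype.val)).subset ?_
  rintro v ⟨hv, hk, -⟩
  refine ⟨v.attach.map fun a => ⟨a.1, hT v hv a.1 a.2⟩, by simp [hk], ?_⟩
  simp [List.map_map, Function.comp_def]

/-- Swapping at `b` makes what precedes `b` irrelevant to what may follow it, so the letters serve
as the states of an automaton. -/
theorem cons_mem_rightContexts {L : Set (List σ)} (hL : SwapClosed L) {a b : σ} {v : List σ} :
    b :: v ∈ rightContexts L a ↔ (∃ v', b :: v' ∈ rightContexts L a) ∧ v ∈ rightContexts L b := by
  constructor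
  · rintro ⟨u, hu⟩
    exact ⟨⟨v, u, hu⟩, u ++ [a], by simpa using hu⟩
  · rintro ⟨⟨v', u, hu⟩, u', hu'⟩
    refine ⟨u, ?_⟩
    have := hL (u ++ [a]) v' u' v b (by simpa using hu) hu'
    simpa using this

theorem cons_mem_iff_of_swapClosed {L : Set (List σ)} (hL : SwapClosed L) {a : σ} {v : List σ} :
    a :: v ∈ L ↔ (∃ v', a :: v' ∈ L) ∧ v ∈ rightContexts L a := by
  constructor
  · intro h
    exact ⟨⟨v, h⟩, [], h⟩
  · rintro ⟨⟨v', h⟩, u', hu'⟩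
    exact hL [] v' u' v a h hu'

theorem mem_of_mem_rightContexts {L : Set (List σ)} {T : Finset σ}
    (hT : ∀ l ∈ L, ∀ a ∈ l, a ∈ T) {a : σ} : ∀ v ∈ rightContexts L a, ∀ b ∈ v, b ∈ T := by
  rintro v ⟨u, hu⟩ b hb
  exact hT _ hu b (by simp [hb])

open Classical in
/-- The number of words whose first letter lies in a set `P`, followed by a word of `K b` with `b`
the first letter. -/
theorem ncard_wordsOfWeight_succ {L : Set (List σ)} {K : σ → Set (List σ)} {P : σ → Prop}
    {T : Finset σ} (hT : ∀ l ∈ L, ∀ a ∈ l, a ∈ T) (hK : ∀ b, ∀ l ∈ K b, ∀ a ∈ l, a ∈ T)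
    (hL : ∀ b v, b :: v ∈ L ↔ P b ∧ v ∈ K b) (w : σ → ℕ) (n k : ℕ) :
    (wordsOfWeight L w n (k + 1)).ncard =
      ∑ b ∈ T, if P b ∧ w b ≤ n then (wordsOfWeight (K b) w (n - w b) k).ncard else 0 := by
  have hU : wordsOfWeight L w n (k + 1) = ((T.filter fun b => P b ∧ w b ≤ n).biUnion fun b =>
      (finite_wordsOfWeight (hK b) w (n - w b) k).toFinset.image (List.cons b) :
        Finset (List σ)) := by
    ext l
    simp only [Finset.coe_biUnion, Finset.coe_filter, Set.mem_ofPred_eq, Finset.coe_image,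
      Set.Finite.coe_toFinset, Set.mem_iUnion, Set.mem_image, exists_prop]
    constructor
    · rintro ⟨hl, hk, hn⟩
      cases l with
      | nil => simp at hk
      | cons b v =>
        have h := (hL b v).1 hl
        simp only [List.map_cons, List.sum_cons, List.length_cons] at hn hk
        exact ⟨b, ⟨hT _ hl b (by simp), h.1, by omega⟩, v, ⟨h.2, by omega, by omega⟩, rfl⟩
    · rintro ⟨b, ⟨-, hb, hbn⟩, v, ⟨hv, hk, hn⟩, rfl⟩
      refine ⟨(hL b v).2 ⟨hb, hv⟩, by simp [hk], ?_⟩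
      simp only [List.map_cons, List.sum_cons]
      omega
  rw [hU, Set.ncard_coe_finset, Finset.card_biUnion, Finset.sum_filter]
  · refine Finset.sum_congr rfl fun b _ => ?_
    rw [Finset.card_image_of_injective _ (List.cons_injective), Set.ncard_eq_toFinset_card _
      (finite_wordsOfWeight (hK b) w (n - w b) k)]
  · intro b _ c _ hbc
    rw [Function.onFun, Finset.disjoint_left]
    intro l hl hl'
    obtain ⟨v, -, rfl⟩ := Finset.mem_image.1 hl
    obtain ⟨v', -, h⟩ := Finset.mem_image.1 hl'
    exact hbc (List.cons.inj h).1.symm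

/-- The exponent of `x ^ i * y ^ j`. -/
noncomputable def expo (i j : ℕ) : Fin 2 →₀ ℕ := Finsupp.single 0 i + Finsupp.single 1 j

@[simp] theorem expo_zero_apply (i j : ℕ) : expo i j 0 = i := by simp [expo]
@[simp] theorem expo_one_apply (i j : ℕ) : expo i j 1 = j := by simp [expo]

theorem expo_le_iff (i j : ℕ) (m : Fin 2 →₀ ℕ) : expo i j ≤ m ↔ i ≤ m 0 ∧ j ≤ m 1 := by
  rw [Finsupp.le_def, Fin.forall_fin_two]; simp

-- One row of the transfer-matrix system: a transition to `b` costs `x ^ w b * y`, and the empty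
-- continuation contributes the constant.
open Classical in
theorem wordSeries_rightContexts {L : Set (List σ)} (hL : SwapClosed L) {T : Finset σ}
    (hT : ∀ l ∈ L, ∀ a ∈ l, a ∈ T) (w : σ → ℕ) (a : σ) :
    wordSeries (rightContexts L a) w =
      ((if [] ∈ rightContexts L a then 1 else 0 : MvPolynomial (Fin 2) ℚ) :
        MvPowerSeries (Fin 2) ℚ) +
      ∑ b ∈ T, ((if ∃ v, b :: v ∈ rightContexts L a then
          MvPolynomial.monomial (expo (w b) 1) 1 else 0 : MvPolynomial (Fin 2) ℚ) :
        MvPowerSeries (Fin 2) ℚ) * wordSeries (rightContexts L b) w := by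
  ext m
  rw [map_add, map_sum]
  have hterm : ∀ b, MvPowerSeries.coeff m (((if ∃ v, b :: v ∈ rightContexts L a then
          MvPolynomial.monomial (expo (w b) 1) 1 else 0 : MvPolynomial (Fin 2) ℚ) :
        MvPowerSeries (Fin 2) ℚ) * wordSeries (rightContexts L b) w) =
      if (∃ v, b :: v ∈ rightContexts L a) ∧ w b ≤ m 0 ∧ 1 ≤ m 1 then
        ((wordsOfWeight (rightContexts L b) w (m 0 - w b) (m 1 - 1)).ncard : ℚ) else 0 := by
    intro b
    by_cases hb : ∃ v, b :: v ∈ rightContexts L a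
    · simp only [hb, if_true, true_and, MvPolynomial.coe_monomial,
        MvPowerSeries.coeff_monomial_mul, expo_le_iff, one_mul]
      congr 1
      change ((wordsOfWeight _ _ ((m - expo (w b) 1) 0) ((m - expo (w b) 1) 1)).ncard : ℚ) = _
      simp
    · simp [hb]
  simp only [hterm]
  change ((wordsOfWeight _ w (m 0) (m 1)).ncard : ℚ) = _
  rcases hm : m 1 with _ | k
  · have h0 : wordsOfWeight (rightContexts L a) w (m 0) 0 =
        if [] ∈ rightContexts L a ∧ m 0 = 0 then {[]} else ∅ := by
      ext v
      by_cases hv : v = []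
      · subst hv
        by_cases h : [] ∈ rightContexts L a <;> by_cases h' : m 0 = 0 <;>
          simp [wordsOfWeight, h, h', eq_comm (a := 0)]
      · have : v.length ≠ 0 := by simpa using hv
        split_ifs <;> simp [wordsOfWeight, hv]
    have hm0 : m = 0 ↔ m 0 = 0 := by
      constructor
      · rintro rfl; rfl
      · intro h; ext i; fin_cases i <;> simp [h, hm]
    rw [h0]
    by_cases h : [] ∈ rightContexts L a <;> by_cases h' : m 0 = 0 <;>
      simp [h, h', MvPowerSeries.coeff_one, hm0]
  · have hm0 : m ≠ 0 := by rintro rfl; simp at hm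
    rw [ncard_wordsOfWeight_succ (mem_of_mem_rightContexts hT)
      (fun b => mem_of_mem_rightContexts (a := b) hT) (fun b v => cons_mem_rightContexts hL) w]
    have : MvPowerSeries.coeff m ((if [] ∈ rightContexts L a then 1 else 0 :
        MvPolynomial (Fin 2) ℚ) : MvPowerSeries (Fin 2) ℚ) = 0 := by
      split_ifs <;> simp [MvPowerSeries.coeff_one, hm0]
    rw [this, zero_add]
    push_cast
    refine Finset.sum_congr rfl fun b _ => ?_
    simp

end Words

/-! ### Linear systems over polynomials and rationality -/

section Rational

theorem isRationalSeries_of_mul_eq {f : MvPowerSeries (Fin 2) ℚ} {P Q : MvPolynomial (Fin 2) ℚ}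
    (hQ : MvPolynomial.constantCoeff Q ≠ 0) (h : (Q : MvPowerSeries (Fin 2) ℚ) * f = P) :
    IsRationalSeries f := by
  refine ⟨P, Q, hQ, ?_⟩
  rw [MvPowerSeries.eq_mul_inv_iff_mul_eq, mul_comm, h]
  rwa [← MvPowerSeries.coeff_zero_eq_constantCoeff_apply, MvPolynomial.coeff_coe]

/-- The solution of a linear system `g = v + M g` over the polynomials, where `M` has no constant
terms, is a vector of rational series with a common denominator. -/
theorem exists_common_denominator {ι : Type*} [Fintype ι] [DecidableEq ι]
    (g : ι → MvPowerSeries (Fin 2) ℚ) (v : ι → MvPolynomial (Fin 2) ℚ)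
    (M : Matrix ι ι (MvPolynomial (Fin 2) ℚ))
    (hM : ∀ a b, MvPolynomial.constantCoeff (M a b) = 0)
    (hg : ∀ a, g a = (v a : MvPowerSeries (Fin 2) ℚ) +
      ∑ b, (M a b : MvPowerSeries (Fin 2) ℚ) * g b) :
    ∃ Q : MvPolynomial (Fin 2) ℚ, MvPolynomial.constantCoeff Q ≠ 0 ∧
      ∀ a, ∃ P : MvPolynomial (Fin 2) ℚ, (Q : MvPowerSeries (Fin 2) ℚ) * g a = P := by
  let φ : MvPolynomial (Fin 2) ℚ →+* MvPowerSeries (Fin 2) ℚ :=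
    MvPolynomial.coeToMvPowerSeries.ringHom
  have hsys : (φ.mapMatrix (1 - M)).mulVec g = fun a => φ (v a) := by
    ext1 a
    rw [map_sub, map_one, Matrix.sub_mulVec, Matrix.one_mulVec, Pi.sub_apply, sub_eq_iff_eq_add]
    exact hg a
  -- Cramer's rule: multiplying the system by the adjugate leaves the determinant as common
  -- denominator.
  have hdet : ∀ a, φ (1 - M).det * g a = φ (((1 - M).adjugate.mulVec v) a) := by
    intro a
    have h1 := congrArg (fun u => (φ.mapMatrix (1 - M)).adjugate.mulVec u a) hsys
    simp only [Matrix.mulVec_mulVec, Matrix.adjugate_mul, Matrix.smul_mulVec, Matrix.one_mulVec,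
      Pi.smul_apply, smul_eq_mul] at h1
    rw [RingHom.map_det, h1, RingHom.map_mulVec, ← RingHom.map_adjugate]
    rfl
  refine ⟨(1 - M).det, ?_, fun a => ⟨_, hdet a⟩⟩
  rw [RingHom.map_det]
  -- At the origin `1 - M` becomes the identity, so the denominator has constant term `1`.
  have : MvPolynomial.constantCoeff.mapMatrix (1 - M) = 1 := by
    rw [map_sub, map_one, sub_eq_self]
    ext a b
    simp [hM]
  rw [this]; simp

open Classical in
/-- The generating function by weight and number of steps of a swap-closed language over a finite
alphabet is rational. -/
theorem isRationalSeries_of_swapClosed {σ : Type*} {L : Set (List σ)} (hL : SwapClosed L)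
    {T : Finset σ} (hT : ∀ l ∈ L, ∀ a ∈ l, a ∈ T) (w : σ → ℕ) :
    IsRationalSeries fun m => ((wordsOfWeight L w (m 0) (m 1 + 1)).ncard : ℚ) := by
  obtain ⟨Q, hQ, hP⟩ := exists_common_denominator
    (fun a : T => wordSeries (rightContexts L a.1) w)
    (fun a => if [] ∈ rightContexts L a.1 then 1 else 0)
    (Matrix.of fun a b : T => if ∃ v, b.1 :: v ∈ rightContexts L a.1 then
      MvPolynomial.monomial (expo (w b) 1) 1 else 0)
    (fun a b => by
      have : expo (w b) 1 ≠ 0 := fun h => by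
        have := congrArg (fun m => m 1) h
        simp at this
      rw [Matrix.of_apply]
      split_ifs
      · rw [MvPolynomial.constantCoeff_monomial, if_neg this]
      · simp)
    (fun a => by
      rw [wordSeries_rightContexts hL hT w a.1]
      congr 1
      rw [← Finset.sum_coe_sort T]
      rfl)
  choose P hP using hP
  refine isRationalSeries_of_mul_eq (Q := Q) (P := ∑ a : T, if ∃ v, a.1 :: v ∈ L then
    MvPolynomial.monomial (expo (w a) 0) 1 * P a else 0) hQ ?_
  -- Words of length `m 1 + 1` are counted, so the first letter carries no factor `y`; hence the
  -- exponent `expo (w a) 0`.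
  have key : (fun m => ((wordsOfWeight L w (m 0) (m 1 + 1)).ncard : ℚ) :
      MvPowerSeries (Fin 2) ℚ) = ∑ a : T, if ∃ v, a.1 :: v ∈ L then
        ((MvPolynomial.monomial (expo (w a) 0) 1 : MvPolynomial (Fin 2) ℚ) :
          MvPowerSeries (Fin 2) ℚ) * wordSeries (rightContexts L a.1) w else 0 := by
    refine MvPowerSeries.ext fun m => ?_
    rw [map_sum]
    refine (?_ : ((wordsOfWeight L w (m 0) (m 1 + 1)).ncard : ℚ) = _)
    rw [ncard_wordsOfWeight_succ hT (fun b => mem_of_mem_rightContexts (a := b) hT)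
      (fun b v => cons_mem_iff_of_swapClosed hL) w, ← Finset.sum_coe_sort T]
    push_cast
    refine Finset.sum_congr rfl fun b _ => ?_
    by_cases hb : ∃ v, b.1 :: v ∈ L
    · simp only [hb, if_true, true_and, MvPowerSeries.coeff_monomial_mul, expo_le_iff, one_mul,
        zero_le, and_true]
      congr 1
      change _ = ((wordsOfWeight _ _ ((m - expo (w b) 0) 0) ((m - expo (w b) 0) 1)).ncard : ℚ)
      simp
    · simp [hb]
  rw [key, Finset.mul_sum]
  change _ = MvPolynomial.coeToMvPowerSeries.ringHom _
  rw [map_sum]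
  refine Finset.sum_congr rfl fun a _ => ?_
  split_ifs
  · rw [map_mul, mul_left_comm, hP]
    rfl
  · simp

end Rational

/-! ### Cutting and interleaving chains of edges -/

section EdgeLists

variable {V : Type*}

/-- A list of directed edges that chains up from the vertex `v`, except that it may jump freely
between vertices outside `X`. -/
def ChainOn (X : Set V) : V → List (V × V) → Prop
  | _, [] => True
  | v, d :: l => (v = d.1 ∨ v ∉ X ∧ d.1 ∉ X) ∧ ChainOn X d.2 l

open Classical in
/-- The sublist of the edges that have an endpoint in `X`. -/
noncomputable def restrictTo (X : Set V) (l : List (V × V)) : List (V × V) :=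
  l.filter fun d => d.1 ∈ X ∨ d.2 ∈ X

theorem mem_restrictTo {X : Set V} {l : List (V × V)} {d : V × V} :
    d ∈ restrictTo X l ↔ d ∈ l ∧ (d.1 ∈ X ∨ d.2 ∈ X) := by
  simp [restrictTo]

theorem restrictTo_cons_of_mem {X : Set V} {l : List (V × V)} {d : V × V}
    (h : d.1 ∈ X ∨ d.2 ∈ X) : restrictTo X (d :: l) = d :: restrictTo X l := by
  simp [restrictTo, h]

theorem restrictTo_cons_of_notMem {X : Set V} {l : List (V × V)} {d : V × V}
    (h : d.1 ∉ X) (h' : d.2 ∉ X) : restrictTo X (d :: l) = restrictTo X l := by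
  simp [restrictTo, h, h']

theorem restrictTo_restrictTo {X Y : Set V} (hXY : X ⊆ Y) (l : List (V × V)) :
    restrictTo X (restrictTo Y l) = restrictTo X l := by
  simp only [restrictTo, List.filter_filter]
  refine List.filter_congr fun d _ => ?_
  have h1 := @hXY d.1
  have h2 := @hXY d.2
  rw [Bool.eq_iff_iff]
  simp only [Bool.and_eq_true, decide_eq_true_eq]
  tauto

theorem ChainOn.congr {X : Set V} {v v' : V} {l : List (V × V)} (hl : ChainOn X v l)
    (hv : v ∉ X) (hv' : v' ∉ X) : ChainOn X v' l := by
  cases l with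
  | nil => trivial
  | cons d l =>
    refine ⟨Or.inr ⟨hv', ?_⟩, hl.2⟩
    rcases hl.1 with h | h
    · exact h ▸ hv
    · exact h.2

/-- A discarded edge has both ends outside `X`, so discarding it leaves only a permitted jump. -/
theorem ChainOn.restrictTo {X : Set V} {v : V} {l : List (V × V)}
    (hl : ChainOn Set.univ v l) : ChainOn X v (restrictTo X l) := by
  induction l generalizing v with
  | nil => trivial
  | cons d l ih =>
    have hv : v = d.1 := by simpa using hl.1
    by_cases h : d.1 ∈ X ∨ d.2 ∈ X
    · rw [restrictTo_cons_of_mem h]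
      exact ⟨Or.inl hv, ih hl.2⟩
    · push Not at h
      rw [restrictTo_cons_of_notMem h.1 h.2]
      exact (ih hl.2).congr h.2 (hv ▸ h.1)

/-- Two edge lists, on a set of vertices and on its complement, with the same crossing edges in the
same order, are the two parts of one chain. -/
theorem exists_amalgam (n : ℕ) : ∀ (X : Set V) (v : V) (A B : List (V × V)),
    A.length + B.length = n → (∀ a ∈ A, a.1 ∈ X ∨ a.2 ∈ X) → (∀ b ∈ B, b.1 ∈ Xᶜ ∨ b.2 ∈ Xᶜ) →
    ChainOn X v A → ChainOn Xᶜ v B → restrictTo Xᶜ A = restrictTo X B →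
    ∃ l, ChainOn Set.univ v l ∧ restrictTo X l = A ∧ restrictTo Xᶜ l = B := by
  induction n using Nat.strong_induction_on with
  | _ n ih =>
  -- The hypotheses are symmetric under exchanging `X` with its complement and `A` with `B`, so it
  -- suffices to treat a start in `X`.
  have main : ∀ (X : Set V) (v : V) (A B : List (V × V)), v ∈ X →
      A.length + B.length = n → (∀ a ∈ A, a.1 ∈ X ∨ a.2 ∈ X) → (∀ b ∈ B, b.1 ∈ Xᶜ ∨ b.2 ∈ Xᶜ) →
      ChainOn X v A → ChainOn Xᶜ v B → restrictTo Xᶜ A = restrictTo X B →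
      ∃ l, ChainOn Set.univ v l ∧ restrictTo X l = A ∧ restrictTo Xᶜ l = B := by
    intro X v A B hv hn hA hB cA cB hAB
    -- While the chain is in `X`, the list `B` waits: its next edge leaves from `X`, hence is a
    -- crossing edge.
    have hBhead : ∀ b B', B = b :: B' → b.1 ∈ X := by
      rintro b B' rfl
      rcases cB.1 with h | h
      · exact h ▸ hv
      · exact not_not.1 h.2
    cases A with
    | nil =>
      cases B with
      | nil => exact ⟨[], trivial, rfl, rfl⟩
      | cons b B =>
        rw [restrictTo_cons_of_mem (Or.inl (hBhead b B rfl))] at hAB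
        simp [restrictTo] at hAB
    | cons a A =>
      have hva : v = a.1 := by
        rcases cA.1 with h | h
        · exact h
        · exact absurd hv h.1
      have ha1 : a.1 ∈ X := hva ▸ hv
      -- An edge inside `X` is taken from `A` alone. A crossing edge is the first one of both lists,
      -- so it is the head of `B` as well and is consumed from both.
      by_cases ha : a.2 ∈ X
      · rw [restrictTo_cons_of_notMem (by simpa) (by simpa)] at hAB
        obtain ⟨l, hl, hlA, hlB⟩ := ih (A.length + B.length) (by simp at hn; omega) X a.2 A B rfl
          (fun x hx => hA x (by simp [hx])) hB cA.2 (cB.congr (by simpa) (by simpa)) hAB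
        refine ⟨a :: l, ⟨Or.inl hva, hl⟩, ?_, ?_⟩
        · rw [restrictTo_cons_of_mem (Or.inl ha1), hlA]
        · rw [restrictTo_cons_of_notMem (by simpa) (by simpa), hlB]
      · rw [restrictTo_cons_of_mem (Or.inr ha)] at hAB
        cases B with
        | nil => simp [restrictTo] at hAB
        | cons b B =>
          rw [restrictTo_cons_of_mem (Or.inl (hBhead b B rfl))] at hAB
          obtain ⟨rfl, hAB'⟩ := List.cons.inj hAB
          obtain ⟨l, hl, hlA, hlB⟩ := ih (A.length + B.length) (by simp at hn; omega) X a.2 A B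
            rfl (fun x hx => hA x (by simp [hx])) (fun x hx => hB x (by simp [hx])) cA.2 cB.2 hAB'
          refine ⟨a :: l, ⟨Or.inl hva, hl⟩, ?_, ?_⟩
          · rw [restrictTo_cons_of_mem (Or.inl ha1), hlA]
          · rw [restrictTo_cons_of_mem (Or.inr ha), hlB]
  intro X v A B hn hA hB cA cB hAB
  by_cases hv : v ∈ X
  · exact main X v A B hv hn hA hB cA cB hAB
  · obtain ⟨l, hl, h1, h2⟩ := main Xᶜ v B A hv (by omega) hB (by simpa using hA) cB
      (by simpa using cA) (by simpa using hAB.symm)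
    exact ⟨l, hl, by simpa using h2, h1⟩

/-- Two chains from the same vertex with the same edges coincide if no two edges of the first have
the same initial vertex. -/
theorem ChainOn.eq_of_perm {v : V} {l l' : List (V × V)} (hl : ChainOn Set.univ v l)
    (hl' : ChainOn Set.univ v l') (hn : (l.map Prod.fst).Nodup) (hp : l.Perm l') : l = l' := by
  induction l generalizing v l' with
  | nil => simpa using hp
  | cons d l ih =>
    cases l' with
    | nil => simp at hp
    | cons d' l' =>
      have h1 : v = d.1 := by simpa using hl.1
      have h1' : v = d'.1 := by simpa using hl'.1
      have hd : d = d' := List.inj_on_of_nodup_map hn (by simp) (hp.mem_iff.2 (by simp))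
        (h1.symm.trans h1')
      subst hd
      rw [ih hl.2 hl'.2 (List.nodup_cons.1 hn).2 ((List.perm_cons d).1 hp)]

end EdgeLists

/-! ### Columns of trapped paths and gluing along a cut -/

section Columns

/-- A directed edge between two points of the plane. -/
abbrev PlaneEdge : Type := (ℤ × ℤ) × (ℤ × ℤ)

/-- The points with first coordinate `t`. -/
def columnSet (t : ℤ) : Set (ℤ × ℤ) := {p | p.1 = t}

@[simp] theorem mem_columnSet {t : ℤ} {p : ℤ × ℤ} : p ∈ columnSet t ↔ p.1 = t := Iff.rfl

/-- The sublist of the edges that touch the column `t`. -/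
noncomputable def column (t : ℤ) (D : List PlaneEdge) : List PlaneEdge :=
  restrictTo (columnSet t) D

theorem mem_column {t : ℤ} {D : List PlaneEdge} {d : PlaneEdge} :
    d ∈ column t D ↔ d ∈ D ∧ (d.1.1 = t ∨ d.2.1 = t) := mem_restrictTo

/-- Horizontal translation of an edge. -/
def shiftEdge (s : ℤ) (d : PlaneEdge) : PlaneEdge := ((d.1.1 + s, d.1.2), (d.2.1 + s, d.2.2))

@[simp] theorem shiftEdge_fst_fst (s : ℤ) (d : PlaneEdge) : (shiftEdge s d).1.1 = d.1.1 + s := rfl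
@[simp] theorem shiftEdge_fst_snd (s : ℤ) (d : PlaneEdge) : (shiftEdge s d).1.2 = d.1.2 := rfl
@[simp] theorem shiftEdge_snd_fst (s : ℤ) (d : PlaneEdge) : (shiftEdge s d).2.1 = d.2.1 + s := rfl
@[simp] theorem shiftEdge_snd_snd (s : ℤ) (d : PlaneEdge) : (shiftEdge s d).2.2 = d.2.2 := rfl

theorem shiftEdge_injective (s : ℤ) : Function.Injective (shiftEdge s) := by
  rintro ⟨⟨a, b⟩, c, d⟩ ⟨⟨a', b'⟩, c', d'⟩ h
  simpa [shiftEdge] using h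

/-- Horizontal translation of a list of edges. -/
def shiftEdges (s : ℤ) (D : List PlaneEdge) : List PlaneEdge := D.map (shiftEdge s)

theorem shiftEdges_shiftEdges (s t : ℤ) (D : List PlaneEdge) :
    shiftEdges s (shiftEdges t D) = shiftEdges (t + s) D := by
  simp [shiftEdges, shiftEdge, Function.comp_def, add_assoc]

@[simp] theorem shiftEdges_zero (D : List PlaneEdge) : shiftEdges 0 D = D := by
  have : shiftEdge 0 = id := by funext d; simp [shiftEdge]
  rw [shiftEdges, this, List.map_id]

theorem column_shiftEdges (s t : ℤ) (D : List PlaneEdge) :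
    column t (shiftEdges s D) = shiftEdges s (column (t - s) D) := by
  simp only [column, restrictTo, shiftEdges, List.filter_map]
  congr 1
  refine List.filter_congr fun d _ => ?_
  rw [Bool.eq_iff_iff]
  simp only [Function.comp_apply, decide_eq_true_eq]
  simp only [mem_columnSet, shiftEdge_fst_fst, shiftEdge_snd_fst, eq_sub_iff_add_eq]

theorem ChainOn.shiftEdges {s : ℤ} {v : ℤ × ℤ} {D : List PlaneEdge}
    (h : ChainOn Set.univ v D) : ChainOn Set.univ (v.1 + s, v.2) (shiftEdges s D) := by
  induction D generalizing v with
  | nil => trivial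
  | cons d D ih =>
    have hv : v = d.1 := by simpa using h.1
    exact ⟨Or.inl (by rw [hv]; rfl), ih h.2⟩

theorem mem_map_fst_column {D : List PlaneEdge} {v : ℤ × ℤ} :
    v ∈ (column v.1 D).map Prod.fst ↔ v ∈ D.map Prod.fst := by
  simp only [List.mem_map, mem_column]
  constructor
  · rintro ⟨d, hd, rfl⟩; exact ⟨d, hd.1, rfl⟩
  · rintro ⟨d, hd, rfl⟩; exact ⟨d, ⟨hd, Or.inl rfl⟩, rfl⟩

theorem mem_map_snd_column {D : List PlaneEdge} {v : ℤ × ℤ} :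
    v ∈ (column v.1 D).map Prod.snd ↔ v ∈ D.map Prod.snd := by
  simp only [List.mem_map, mem_column]
  constructor
  · rintro ⟨d, hd, rfl⟩; exact ⟨d, hd.1, rfl⟩
  · rintro ⟨d, hd, rfl⟩; exact ⟨d, ⟨hd, Or.inr rfl⟩, rfl⟩

/-- All occurrences of a vertex come from edges touching its own column, so multiplicities can be
counted there. This makes self-avoidance local. -/
theorem nodup_map_of_column {f : PlaneEdge → ℤ × ℤ} (hf : ∀ d, f d = d.1 ∨ f d = d.2)
    {D : List PlaneEdge} (h : ∀ t, ((column t D).map f).Nodup) : (D.map f).Nodup := by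
  rw [List.nodup_iff_count_le_one]
  intro v
  refine le_trans (le_of_eq ?_) (List.nodup_iff_count_le_one.1 (h v.1) v)
  simp only [List.count, List.countP_map, column, restrictTo, List.countP_filter]
  refine List.countP_congr fun d _ => ?_
  simp only [Function.comp_apply, beq_iff_eq, mem_columnSet, Bool.and_eq_true, decide_eq_true_eq]
  refine ⟨fun hd => ⟨hd, ?_⟩, fun hd => hd.1⟩
  rcases hf d with h' | h' <;> rw [← hd, h'] <;> simp

theorem nodup_map_column {f : PlaneEdge → ℤ × ℤ} {D : List PlaneEdge} (h : (D.map f).Nodup)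
    (t : ℤ) : ((column t D).map f).Nodup :=
  h.sublist (List.filter_sublist.map f)

/-- Two points at Euclidean distance `1`. -/
def UnitDist (p q : ℤ × ℤ) : Prop := (p.1 - q.1) ^ 2 + (p.2 - q.2) ^ 2 = 1

theorem UnitDist.fst_le {p q : ℤ × ℤ} (h : UnitDist p q) : p.1 ≤ q.1 + 1 ∧ q.1 ≤ p.1 + 1 := by
  have h : (p.1 - q.1) ^ 2 + (p.2 - q.2) ^ 2 = 1 := h
  have h3 : |p.1 - q.1| ≤ 1 := by
    rw [← sq_le_one_iff_abs_le_one]; nlinarith [sq_nonneg (p.2 - q.2)]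
  rw [abs_le] at h3
  omega

/-- The list of the directed edges of a self-avoiding walk on the strip of height `h` that starts
in the top-left corner and is trapped, described by conditions local to adjacent columns apart from
the chain condition. -/
structure IsTrappedPath (h : ℕ) (D : List PlaneEdge) : Prop where
  chain : ChainOn Set.univ (0, (h : ℤ) - 1) D
  mem_strip : ∀ d ∈ D, d.1 ∈ stripSet h ∧ d.2 ∈ stripSet h
  unitDist : ∀ d ∈ D, UnitDist d.1 d.2
  nodup_fst : (D.map Prod.fst).Nodup
  nodup_snd : (D.map Prod.snd).Nodup
  start_notMem : (0, (h : ℤ) - 1) ∉ D.map Prod.snd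
  trapped : ∀ v ∈ D.map Prod.snd, v ∉ D.map Prod.fst → ∀ w ∈ stripSet h, UnitDist v w →
    w ∈ D.map Prod.fst ∨ w ∈ D.map Prod.snd

/-- The edges at the column `t`, translated to the column `0`. -/
noncomputable def normalColumn (D : List PlaneEdge) (t : ℤ) : List PlaneEdge :=
  shiftEdges (-t) (column t D)

theorem column_eq_of_normalColumn_eq {D D' : List PlaneEdge} {s t : ℤ}
    (h : normalColumn D s = normalColumn D' t) :
    column s D = shiftEdges (s - t) (column t D') := by
  have := congrArg (shiftEdges s) h
  simp only [normalColumn, shiftEdges_shiftEdges] at this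
  rw [neg_add_cancel, shiftEdges_zero] at this
  rw [this]
  congr 1
  ring

theorem normalColumn_eq_of_column_eq {D D' : List PlaneEdge} {s t : ℤ}
    (h : column s D = shiftEdges (s - t) (column t D')) :
    normalColumn D s = normalColumn D' t := by
  rw [normalColumn, h, shiftEdges_shiftEdges, normalColumn]
  congr 1
  ring

/-- The part of `D` left of a cut can be glued to the part of `D'` right of a cut if the two columns
on either side of the cut look the same in both. -/
theorem IsTrappedPath.exists_glue {h : ℕ} {D D' : List PlaneEdge} (hD : IsTrappedPath h D)
    (hD' : IsTrappedPath h D') {i j : ℤ} (hi : 0 ≤ i) (hj : 0 ≤ j)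
    (h0 : normalColumn D i = normalColumn D' j)
    (h1 : normalColumn D (i + 1) = normalColumn D' (j + 1)) :
    ∃ E, IsTrappedPath h E ∧ (∀ t, t ≤ i + 1 → column t E = column t D) ∧
      ∀ t, i ≤ t → column t E = shiftEdges (i - j) (column (t - (i - j)) D') := by
  set s := i - j with hs
  set D₂ := shiftEdges s D' with hD₂
  have hmem₂ : ∀ d ∈ D₂, ∃ e ∈ D', shiftEdge s e = d := fun d hd => List.mem_map.1 hd
  have hu₂ : ∀ d ∈ D₂, UnitDist d.1 d.2 := by
    intro d hd
    obtain ⟨e, he, rfl⟩ := hmem₂ d hd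
    simpa [UnitDist] using hD'.unitDist e he
  have c0 : column i D = column i D₂ := by
    rw [column_eq_of_normalColumn_eq h0, hD₂, column_shiftEdges]
    congr 2; omega
  have c1 : column (i + 1) D = column (i + 1) D₂ := by
    rw [column_eq_of_normalColumn_eq h1, hD₂, column_shiftEdges,
      show i + 1 - (j + 1) = s by omega, show i + 1 - s = j + 1 by omega]
  let X : Set (ℤ × ℤ) := {p | p.1 ≤ i}
  have hX : ∀ p, p ∈ X ↔ p.1 ≤ i := fun p => Iff.rfl
  have hXc : ∀ p, p ∈ Xᶜ ↔ i < p.1 := fun p => by simp [X]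
  -- A unit edge crossing the cut between columns `i` and `i + 1` has an end in column `i`, so that
  -- column determines the crossing edges and their order.
  have cross : ∀ F : List PlaneEdge, (∀ d ∈ F, UnitDist d.1 d.2) →
      restrictTo Xᶜ (restrictTo X F) = restrictTo Xᶜ (restrictTo X (column i F)) ∧
      restrictTo X (restrictTo Xᶜ F) = restrictTo Xᶜ (restrictTo X (column i F)) := by
    intro F hF
    simp only [restrictTo, column, List.filter_filter]
    constructor <;>
    · refine List.filter_congr fun d hd => ?_
      have := (hF d hd).fst_le
      rw [Bool.eq_iff_iff]
      simp only [hX, hXc, mem_columnSet, Bool.and_eq_true, decide_eq_true_eq]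
      omega
  obtain ⟨E, hE, hEX, hEY⟩ := exists_amalgam _ X (0, (h : ℤ) - 1) (restrictTo X D)
    (restrictTo Xᶜ D₂) rfl (fun a ha => (mem_restrictTo.1 ha).2)
    (fun a ha => (mem_restrictTo.1 ha).2) hD.chain.restrictTo
    -- The translated walk starts in column `i - j`, the glued one in column `0`. As `0 ≤ j` and `0
    -- ≤ i`, both starts lie left of the cut, where the right part may jump freely.
    ((hD'.chain.shiftEdges (s := s)).restrictTo.congr
      (by rw [hXc]; dsimp only; omega) (by rw [hXc]; dsimp only; omega))
    (by rw [(cross D hD.unitDist).1, (cross D₂ hu₂).2, c0])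
  have hcolX : ∀ t ≤ i, column t E = column t D := by
    intro t ht
    have hsub : columnSet t ⊆ X := by rintro p rfl; exact ht
    rw [column, column, ← restrictTo_restrictTo hsub, hEX, restrictTo_restrictTo hsub]
  have hcolY : ∀ t, i < t → column t E = column t D₂ := by
    intro t ht
    have hsub : columnSet t ⊆ Xᶜ := by rintro p rfl; rw [hXc]; exact ht
    rw [column, column, ← restrictTo_restrictTo hsub, hEY, restrictTo_restrictTo hsub]
  -- Both descriptions of `E` are extended by one column, so that a vertex and all its neighbours
  -- are always covered by a single one of them. Trapping needs this.
  have hcolX' : ∀ t ≤ i + 1, column t E = column t D := by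
    intro t ht
    rcases ht.lt_or_eq with ht | rfl
    · exact hcolX t (by omega)
    · rw [hcolY _ (by omega), c1]
  have hcolY' : ∀ t, i ≤ t → column t E = column t D₂ := by
    intro t ht
    rcases ht.lt_or_eq with ht | rfl
    · exact hcolY t ht
    · rw [hcolX _ le_rfl, c0]
  have hmem : ∀ d ∈ E, d ∈ D ∨ d ∈ D₂ ∧ i < d.1.1 := by
    intro d hd
    rcases le_or_gt d.1.1 i with hd' | hd'
    · have : d ∈ column d.1.1 E := mem_column.2 ⟨hd, Or.inl rfl⟩
      rw [hcolX _ hd'] at this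
      exact Or.inl (mem_column.1 this).1
    · have : d ∈ column d.1.1 E := mem_column.2 ⟨hd, Or.inl rfl⟩
      rw [hcolY _ hd'] at this
      exact Or.inr ⟨(mem_column.1 this).1, hd'⟩
  have hnodup₂ : (D₂.map Prod.fst).Nodup ∧ (D₂.map Prod.snd).Nodup := by
    have hinj : Function.Injective fun p : ℤ × ℤ => (p.1 + s, p.2) := by
      rintro ⟨a, b⟩ ⟨c, d⟩ hp
      simpa using hp
    have e1 : D₂.map Prod.fst = (D'.map Prod.fst).map fun p : ℤ × ℤ => (p.1 + s, p.2) := by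
      simp [hD₂, shiftEdges, shiftEdge, Function.comp_def]
    have e2 : D₂.map Prod.snd = (D'.map Prod.snd).map fun p : ℤ × ℤ => (p.1 + s, p.2) := by
      simp [hD₂, shiftEdges, shiftEdge, Function.comp_def]
    rw [e1, e2]
    exact ⟨hD'.nodup_fst.map hinj, hD'.nodup_snd.map hinj⟩
  have hfst₂ : ∀ v, v ∈ D₂.map Prod.fst ↔ (v.1 - s, v.2) ∈ D'.map Prod.fst := by
    rintro ⟨a, b⟩
    simp [hD₂, shiftEdges, shiftEdge, ← eq_sub_iff_add_eq]
  have hsnd₂ : ∀ v, v ∈ D₂.map Prod.snd ↔ (v.1 - s, v.2) ∈ D'.map Prod.snd := by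
    rintro ⟨a, b⟩
    simp [hD₂, shiftEdges, shiftEdge, ← eq_sub_iff_add_eq]
  refine ⟨E, ⟨hE, ?_, ?_, ?_, ?_, ?_, ?_⟩, hcolX', fun t ht => ?_⟩
  · intro d hd
    rcases hmem d hd with hd | ⟨hd, hdi⟩
    · exact hD.mem_strip d hd
    -- Translation could push edges of `D'` out of the strip on the left; those kept start right of
    -- column `i ≥ 0`, so both their ends stay inside.
    · have hud := (hu₂ d hd).fst_le
      obtain ⟨e, he, rfl⟩ := hmem₂ d hd
      have := hD'.mem_strip e he
      refine ⟨⟨?_, this.1.2⟩, ?_, this.2.2⟩ <;> omega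
  · intro d hd
    rcases hmem d hd with hd | ⟨hd, -⟩
    · exact hD.unitDist d hd
    · exact hu₂ d hd
  · refine nodup_map_of_column (fun d => Or.inl rfl) fun t => ?_
    rcases le_or_gt t i with ht | ht
    · rw [hcolX t ht]; exact nodup_map_column hD.nodup_fst t
    · rw [hcolY t ht]; exact nodup_map_column hnodup₂.1 t
  · refine nodup_map_of_column (fun d => Or.inr rfl) fun t => ?_
    rcases le_or_gt t i with ht | ht
    · rw [hcolX t ht]; exact nodup_map_column hD.nodup_snd t
    · rw [hcolY t ht]; exact nodup_map_column hnodup₂.2 t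
  · intro hstart
    rw [← mem_map_snd_column, hcolX _ hi] at hstart
    exact hD.start_notMem (mem_map_snd_column.1 hstart)
  · intro v hv hv' w hw hvw
    have hle := hvw.fst_le
    rw [← mem_map_snd_column] at hv
    rw [← mem_map_fst_column] at hv'
    rw [← mem_map_snd_column, ← mem_map_fst_column]
    rcases le_or_gt v.1 i with hvi | hvi
    · rw [hcolX' _ (by omega)] at hv hv' ⊢
      rw [mem_map_snd_column] at hv ⊢
      rw [mem_map_fst_column] at hv' ⊢
      exact hD.trapped v hv hv' w hw hvw
    · rw [hcolY' _ (by omega)] at hv hv' ⊢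
      rw [mem_map_snd_column, hsnd₂] at hv ⊢
      rw [mem_map_fst_column, hfst₂] at hv' ⊢
      refine hD'.trapped _ hv hv' _ ⟨?_, hw.2⟩ ?_
      · dsimp only; omega
      · simpa [UnitDist] using hvw
  · rw [hcolY' t ht, hD₂, column_shiftEdges]

end Columns

/-! ### The language of column words -/

section ColumnWords

/-- A letter: the edges at two adjacent columns, each translated to the column `0`. -/
abbrev Letter : Type := List PlaneEdge × List PlaneEdge

/-- The letter of an edge list at the column `t`. -/
noncomputable def letter (D : List PlaneEdge) (t : ℤ) : Letter :=
  (normalColumn D t, normalColumn D (t + 1))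

/-- The letters at the columns `0, …, k`. -/
noncomputable def columnWord (D : List PlaneEdge) (k : ℕ) : List Letter :=
  (List.range (k + 1)).map fun t : ℕ => letter D t

/-- The rightmost column that `D` touches is the column `k`. -/
def HasWidth (D : List PlaneEdge) (k : ℕ) : Prop :=
  column k D ≠ [] ∧ ∀ t : ℤ, k < t → column t D = []

theorem HasWidth.fst_le {D : List PlaneEdge} {k : ℕ} (hk : HasWidth D k) {d : PlaneEdge}
    (hd : d ∈ D) : d.1.1 ≤ k := by
  by_contra! h
  have : d ∈ column d.1.1 D := mem_column.2 ⟨hd, Or.inl rfl⟩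
  rw [hk.2 _ h] at this
  simp at this

/-- The words of all trapped paths on the strip of height `h`. -/
def columnLanguage (h : ℕ) : Set (List Letter) :=
  {l | ∃ D k, IsTrappedPath h D ∧ HasWidth D k ∧ l = columnWord D k}

/-- A common letter means that both columns at the cut agree up to translation, which is what gluing
requires. The glued path inherits its right end from `D'`. -/
theorem swapClosed_columnLanguage (h : ℕ) : SwapClosed (columnLanguage h) := by
  rintro u v u' v' a ⟨D, k, hD, -, hw⟩ ⟨D', k', hD', hk', hw'⟩
  have get : ∀ n, n < k + 1 → (u ++ a :: v)[n]? = some (letter D n) := by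
    intro n hn
    simp [hw, columnWord, hn]
  have get' : ∀ n, n < k' + 1 → (u' ++ a :: v')[n]? = some (letter D' n) := by
    intro n hn
    simp [hw', columnWord, hn]
  have len : u.length + (v.length + 1) = k + 1 := by
    simpa [columnWord] using congrArg List.length hw
  have len' : u'.length + (v'.length + 1) = k' + 1 := by
    simpa [columnWord] using congrArg List.length hw'
  have ha : a = letter D u.length := by simpa using get u.length (by omega)
  have ha' : a = letter D' u'.length := by simpa using get' u'.length (by omega)
  obtain ⟨h0, h1⟩ := Prod.ext_iff.1 (ha.symm.trans ha')
  obtain ⟨E, hE, hl, hr⟩ := hD.exists_glue hD' (Int.natCast_nonneg _) (Int.natCast_nonneg _) h0 h1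
  have letl : ∀ n : ℕ, n ≤ u.length → letter E n = letter D n := by
    intro n hn
    simp only [letter, normalColumn]
    rw [hl _ (by omega), hl _ (by omega)]
  have normr : ∀ m : ℤ, 0 ≤ m →
      normalColumn E (u.length + m) = normalColumn D' (u'.length + m) := by
    intro m hm
    refine normalColumn_eq_of_column_eq ?_
    rw [hr _ (by omega), add_sub_add_right_eq_sub, ← sub_add, add_sub_right_comm, sub_self,
      zero_add, add_comm m]
  have letr : ∀ n : ℕ, letter E (u.length + n : ℕ) = letter D' (u'.length + n : ℕ) := by
    intro n
    simp only [letter, Nat.cast_add, add_assoc]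
    rw [normr _ (by omega), normr _ (by omega)]
  refine ⟨E, u.length + v'.length, hE, ⟨?_, ?_⟩, ?_⟩
  · rw [hr _ (by omega), show ((u.length + v'.length : ℕ) : ℤ) - (u.length - u'.length) = k' by
      omega]
    simpa [shiftEdges] using hk'.1
  · intro t ht
    rw [hr _ (by omega), hk'.2 _ (by omega)]
    rfl
  · refine List.ext_getElem? fun n => ?_
    rcases lt_trichotomy n u.length with hn | rfl | hn
    · have := get n (by omega)
      rw [List.getElem?_append_left hn] at this ⊢
      rw [this, ← letl n hn.le]
      simp [columnWord, show n < u.length + v'.length + 1 by omega]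
    · simp [columnWord, ha, letl u.length le_rfl]
    · obtain ⟨m, rfl⟩ := Nat.exists_eq_add_of_lt hn
      rw [List.getElem?_append_right (by omega)]
      by_cases hm : m < v'.length
      · have := get' (u'.length + m + 1) (by omega)
        rw [List.getElem?_append_right (by omega)] at this
        rw [show u.length + m + 1 - u.length = u'.length + m + 1 - u'.length by omega, this,
          add_assoc, ← letr]
        simp [columnWord, ← add_assoc, show u.length + m + 1 < u.length + v'.length + 1 by omega]
      · rw [List.getElem?_eq_none (by simp; omega), List.getElem?_eq_none]
        simp [columnWord]
        omega

/-- The number of edges of a letter that start in its first column. -/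
def letterWeight (a : Letter) : ℕ := a.1.countP fun d => d.1.1 = 0

theorem sum_map_range_countP {α : Type*} (f : α → ℤ) (k : ℕ) (D : List α)
    (hD : ∀ d ∈ D, 0 ≤ f d ∧ f d ≤ k) :
    ((List.range (k + 1)).map fun t : ℕ => D.countP fun d => f d = t).sum = D.length := by
  change ∑ t ∈ Finset.range (k + 1), (D.countP fun d => f d = (t : ℤ)) = D.length
  induction D with
  | nil => simp
  | cons d D ih =>
    have hd := hD d (by simp)
    obtain ⟨m, hm⟩ := Int.eq_ofNat_of_zero_le hd.1
    simp only [List.countP_cons, Finset.sum_add_distrib, ih fun x hx => hD x (by simp [hx])]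
    simp [hm, show m < k + 1 by omega]

/-- Each edge has exactly one initial column, so it is counted once although it may appear in
several letters. -/
theorem sum_letterWeight_columnWord {h : ℕ} {D : List PlaneEdge} (hD : IsTrappedPath h D) {k : ℕ}
    (hk : HasWidth D k) : ((columnWord D k).map letterWeight).sum = D.length := by
  rw [← sum_map_range_countP (fun d : PlaneEdge => d.1.1) k D
    fun d hd => ⟨(hD.mem_strip d hd).1.1, hk.fst_le hd⟩]
  rw [columnWord, List.map_map]
  congr 1
  refine List.map_congr_left fun t _ => ?_
  simp only [Function.comp_apply, letterWeight, letter, normalColumn, shiftEdges, List.countP_map,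
    column, restrictTo, List.countP_filter]
  refine List.countP_congr fun d _ => ?_
  simp only [Bool.and_eq_true, decide_eq_true_eq]
  simp only [mem_columnSet, shiftEdge_fst_fst]
  omega

/-- The columns determine the set of edges, and a chain whose edges have distinct initial vertices
is determined by its start and that set. -/
theorem columnWord_injective {h : ℕ} {D D' : List PlaneEdge} (hD : IsTrappedPath h D)
    (hD' : IsTrappedPath h D') {k : ℕ} (hk : HasWidth D k) (hk' : HasWidth D' k)
    (hw : columnWord D k = columnWord D' k) : D = D' := by
  have hcol : ∀ t : ℤ, 0 ≤ t → t ≤ k → column t D = column t D' := by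
    intro t ht htk
    lift t to ℕ using ht
    have := List.map_inj_left.1 hw t (by simp; omega)
    simpa using column_eq_of_normalColumn_eq (congrArg Prod.fst this)
  refine hD.chain.eq_of_perm hD'.chain hD.nodup_fst
    ((List.perm_ext_iff_of_nodup hD.nodup_fst.of_map hD'.nodup_fst.of_map).2 fun d => ⟨?_, ?_⟩)
  · intro hd
    have : d ∈ column d.1.1 D := mem_column.2 ⟨hd, Or.inl rfl⟩
    rw [hcol _ (hD.mem_strip d hd).1.1 (hk.fst_le hd)] at this
    exact (mem_column.1 this).1
  · intro hd
    have : d ∈ column d.1.1 D' := mem_column.2 ⟨hd, Or.inl rfl⟩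
    rw [← hcol _ (hD'.mem_strip d hd).1.1 (hk'.fst_le hd)] at this
    exact (mem_column.1 this).1

theorem finite_setOf_nodup_subset {α : Type*} {S : Set α} (hS : S.Finite) :
    {l : List α | l.Nodup ∧ ∀ a ∈ l, a ∈ S}.Finite := by
  classical
  have := hS.fintype
  refine (Set.finite_range fun l : {l : List S // l.Nodup} => l.1.map Subtype.val).subset ?_
  rintro l ⟨hl, hlS⟩
  have hm : (l.attach.map fun a => (⟨a.1, hlS a.1 a.2⟩ : S)).map Subtype.val = l := by
    simp [List.map_map, Function.comp_def]
  refine ⟨⟨l.attach.map fun a => ⟨a.1, hlS a.1 a.2⟩, ?_⟩, hm⟩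
  exact List.Nodup.of_map Subtype.val (hm.symm ▸ hl)

/-- The words of the trapped paths are written in a finite alphabet. -/
theorem exists_alphabet (h : ℕ) :
    ∃ T : Finset Letter, ∀ l ∈ columnLanguage h, ∀ a ∈ l, a ∈ T := by
  -- A unit edge touching column `0` has both ends in columns `-1`, `0`, `1`.
  let B : Set (ℤ × ℤ) := Set.Icc (-1) 1 ×ˢ Set.Ico 0 (h : ℤ)
  have hB : B.Finite := (Set.finite_Icc _ _).prod (Set.finite_Ico _ _)
  have hfin := finite_setOf_nodup_subset (hB.prod hB)
  refine ⟨(hfin.prod hfin).toFinset, ?_⟩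
  rintro _ ⟨D, k, hD, -, rfl⟩ a ha
  obtain ⟨t, -, rfl⟩ := List.mem_map.1 ha
  have hcol : ∀ t, normalColumn D t ∈
      {l : List PlaneEdge | l.Nodup ∧ ∀ a ∈ l, a ∈ B ×ˢ B} := by
    intro t
    refine ⟨(nodup_map_column hD.nodup_fst t).of_map.map (shiftEdge_injective _), ?_⟩
    intro d hd
    obtain ⟨e, he, rfl⟩ := List.mem_map.1 hd
    obtain ⟨heD, het⟩ := mem_column.1 he
    have hu := (hD.unitDist e heD).fst_le
    obtain ⟨⟨-, h1⟩, -, h2⟩ := hD.mem_strip e heD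
    simp only [B, Set.mem_prod, Set.mem_Icc, Set.mem_Ico, shiftEdge_fst_fst, shiftEdge_fst_snd,
      shiftEdge_snd_fst, shiftEdge_snd_snd]
    omega
  rw [Set.Finite.mem_toFinset]
  exact ⟨hcol _, hcol _⟩

end ColumnWords

/-! ### The dictionary between walks and words -/

section Walks

variable {S : Set (ℤ × ℤ)}

/-- The list of the directed edges of a walk on a grid graph. -/
def edgeList {u v : S} (p : (gridGraph S).Walk u v) : List PlaneEdge :=
  p.darts.map fun d => (d.fst.1, d.snd.1)

theorem map_snd_edgeList {u v : S} (p : (gridGraph S).Walk u v) :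
    u.1 :: (edgeList p).map Prod.snd = p.support.map Subtype.val := by
  rw [← p.cons_map_snd_darts]
  simp [edgeList, Function.comp_def]

theorem map_fst_edgeList {u v : S} (p : (gridGraph S).Walk u v) :
    (edgeList p).map Prod.fst ++ [v.1] = p.support.map Subtype.val := by
  rw [← p.map_fst_darts_append]
  simp [edgeList, Function.comp_def]

theorem chainOn_edgeList {u v : S} (p : (gridGraph S).Walk u v) :
    ChainOn Set.univ u.1 (edgeList p) := by
  induction p with
  | nil => trivial
  | cons hab p ih => exact ⟨Or.inl rfl, ih⟩

theorem exists_walk_of_chainOn {D : List PlaneEdge} {u : S} (hc : ChainOn Set.univ u.1 D)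
    (hS : ∀ d ∈ D, d.2 ∈ S) (hu : ∀ d ∈ D, UnitDist d.1 d.2) :
    ∃ (v : S) (p : (gridGraph S).Walk u v), edgeList p = D := by
  induction D generalizing u with
  | nil => exact ⟨u, .nil, rfl⟩
  | cons d D ih =>
    have hud : u.1 = d.1 := by simpa using hc.1
    let w : S := ⟨d.2, hS d (by simp)⟩
    obtain ⟨v, p, hp⟩ := ih (u := w) hc.2 (fun x hx => hS x (by simp [hx]))
      (fun x hx => hu x (by simp [hx]))
    have hadj : (gridGraph S).Adj u w := by
      have := hu d (by simp)
      rw [← hud] at this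
      exact this
    refine ⟨v, .cons hadj p, ?_⟩
    change (u.1, d.2) :: edgeList p = d :: D
    rw [hp, hud]

theorem GSAW.ext_of_edgeList_eq {u : S} {W W' : GSAW (gridGraph S) u}
    (h : edgeList W.walk = edgeList W'.walk) : W = W' := by
  obtain ⟨a, p, hp, tp⟩ := W
  obtain ⟨b, q, hq, tq⟩ := W'
  have hs : p.support = q.support := by
    apply List.map_injective_iff.2 Subtype.val_injective
    rw [← map_snd_edgeList, ← map_snd_edgeList]
    exact congrArg _ (congrArg _ h)
  have hab : a = b := by
    rw [← p.getLast_support, ← q.getLast_support]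
    simp only [hs]
  subst hab
  obtain rfl : p = q := SimpleGraph.Walk.ext_support hs
  rfl

variable {h : ℕ} {hh : 1 ≤ h}

theorem mem_stripSet {p : ℤ × ℤ} : p ∈ stripSet h ↔ 0 ≤ p.1 ∧ 0 ≤ p.2 ∧ p.2 < (h : ℤ) := Iff.rfl

/-- The corner always has a right-hand neighbour, so the trivial walk is not trapped. Hence every
vertex of a trapped walk, the start included, is an end of some edge. -/
theorem GSAW.edgeList_ne_nil (W : GSAW (stripGraph h) (topLeft h hh)) : edgeList W.walk ≠ [] := by
  obtain ⟨b, p, hp, tp⟩ := W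
  intro hnil
  cases p with
  | cons hab p => simp [edgeList] at hnil
  | nil =>
    have := tp ⟨(1, (h : ℤ) - 1), by rw [mem_stripSet]; dsimp only; omega⟩ (by
      simp [gridGraph, topLeft])
    simpa [topLeft] using congrArg (fun p : stripSet h => p.1.1) (List.mem_singleton.1 this)

theorem GSAW.isTrappedPath (W : GSAW (stripGraph h) (topLeft h hh)) :
    IsTrappedPath h (edgeList W.walk) := by
  have hsnd := map_snd_edgeList W.walk
  have hfst := map_fst_edgeList W.walk
  have hnd : (W.walk.support.map Subtype.val).Nodup :=
    W.isPath.support_nodup.map Subtype.val_injective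
  refine ⟨chainOn_edgeList W.walk, ?_, ?_, ?_, ?_, ?_, ?_⟩
  · intro d hd
    obtain ⟨e, -, rfl⟩ := List.mem_map.1 hd
    exact ⟨e.fst.2, e.snd.2⟩
  · intro d hd
    obtain ⟨e, -, rfl⟩ := List.mem_map.1 hd
    exact e.adj
  · rw [← hfst] at hnd
    exact hnd.of_append_left
  · rw [← hsnd] at hnd
    exact (List.nodup_cons.1 hnd).2
  · rw [← hsnd] at hnd
    exact (List.nodup_cons.1 hnd).1
  · intro v hv hv' w hw hvw
    -- The last vertex is the only vertex of the walk at which no edge starts.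
    have hvl : v = W.last.1 := by
      have : v ∈ W.walk.support.map Subtype.val := by
        rw [← hsnd]; exact List.mem_cons_of_mem _ hv
      rw [← hfst] at this
      simpa [hv'] using this
    subst hvl
    have hws := W.trapped ⟨w, hw⟩ hvw
    have : w ∈ W.walk.support.map Subtype.val := List.mem_map.2 ⟨_, hws, rfl⟩
    rw [← hsnd] at this
    rcases List.mem_cons.1 this with rfl | hmem
    · left
      obtain ⟨d, D, hD⟩ := List.exists_cons_of_ne_nil W.edgeList_ne_nil
      have hc := chainOn_edgeList W.walk
      rw [hD] at hc ⊢
      have : (topLeft h hh).1 = d.1 := by simpa using hc.1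
      simp [this]
    · exact Or.inr hmem

theorem IsTrappedPath.exists_gsaw {D : List PlaneEdge} (hD : IsTrappedPath h D) (hne : D ≠ []) :
    ∃ W : GSAW (stripGraph h) (topLeft h hh), edgeList W.walk = D := by
  obtain ⟨v, p, rfl⟩ := exists_walk_of_chainOn (u := topLeft h hh) hD.chain
    (fun d hd => (hD.mem_strip d hd).2) hD.unitDist
  have hsnd := map_snd_edgeList p
  have hfst := map_fst_edgeList p
  have hnd : (p.support.map Subtype.val).Nodup := by
    rw [← hsnd]
    exact List.nodup_cons.2 ⟨hD.start_notMem, hD.nodup_snd⟩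
  refine ⟨⟨v, p, .mk' hnd.of_map, fun w hw => ?_⟩, rfl⟩
  have hv : v.1 ∉ (edgeList p).map Prod.fst := by
    rw [← hfst] at hnd
    intro hv
    exact List.disjoint_of_nodup_append hnd hv (by simp)
  have hv' : v.1 ∈ (edgeList p).map Prod.snd := by
    have : v.1 ∈ p.support.map Subtype.val := List.mem_map.2 ⟨v, p.end_mem_support, rfl⟩
    rw [← hsnd] at this
    rcases List.mem_cons.1 this with hmem | hmem
    · exfalso
      apply hv
      obtain ⟨d, D, hD'⟩ := List.exists_cons_of_ne_nil hne
      have hc := chainOn_edgeList p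
      rw [hD'] at hc ⊢
      have : (topLeft h hh).1 = d.1 := by simpa using hc.1
      simp [hmem, this]
    · exact hmem
  have hws : w.1 ∈ p.support.map Subtype.val := by
    rcases hD.trapped v.1 hv' hv w.1 w.2 hw with hmem | hmem
    · rw [← hfst]; exact List.mem_append_left _ hmem
    · rw [← hsnd]; exact List.mem_cons_of_mem _ hmem
  obtain ⟨w', hw', hww'⟩ := List.mem_map.1 hws
  rwa [← Subtype.ext hww']

theorem GSAW.column_edgeList_ne_nil_iff (W : GSAW (stripGraph h) (topLeft h hh)) (t : ℤ) :
    column t (edgeList W.walk) ≠ [] ↔ t ∈ W.xCoords := by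
  have hx : t ∈ W.xCoords ↔ ∃ p ∈ W.walk.support.map Subtype.val, p.1 = t := by
    simp [GSAW.xCoords]
  rw [hx, Ne, List.eq_nil_iff_forall_not_mem, not_forall_not]
  constructor
  · rintro ⟨d, hd⟩
    obtain ⟨hd, ht | ht⟩ := mem_column.1 hd
    · refine ⟨d.1, ?_, ht⟩
      rw [← map_fst_edgeList]
      exact List.mem_append_left _ (List.mem_map_of_mem hd)
    · refine ⟨d.2, ?_, ht⟩
      rw [← map_snd_edgeList]
      exact List.mem_cons_of_mem _ (List.mem_map_of_mem hd)
  · rintro ⟨p, hp, rfl⟩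
    rw [← map_snd_edgeList] at hp
    rcases List.mem_cons.1 hp with rfl | hp
    · obtain ⟨d, D, hD⟩ := List.exists_cons_of_ne_nil W.edgeList_ne_nil
      have hc := chainOn_edgeList W.walk
      rw [hD] at hc ⊢
      have : (topLeft h hh).1 = d.1 := by simpa using hc.1
      exact ⟨d, mem_column.2 ⟨by simp, Or.inl (by rw [this])⟩⟩
    · obtain ⟨d, hd, rfl⟩ := List.mem_map.1 hp
      exact ⟨d, mem_column.2 ⟨hd, Or.inr rfl⟩⟩

/-- The walk starts in the leftmost column `0` of the strip, so its displacement is its largest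
first coordinate. -/
theorem GSAW.displacement_eq_iff (W : GSAW (stripGraph h) (topLeft h hh)) (k : ℕ) :
    W.displacement = k ↔ HasWidth (edgeList W.walk) k := by
  have h0 : (0 : ℤ) ∈ W.xCoords := by
    simp only [GSAW.xCoords, List.mem_toFinset, List.mem_map]
    exact ⟨topLeft h hh, W.walk.start_mem_support, rfl⟩
  have hmin : W.xCoords.min' W.xCoords_nonempty = 0 := by
    refine le_antisymm (Finset.min'_le _ _ h0) (Finset.le_min' _ _ _ fun t ht => ?_)
    simp only [GSAW.xCoords, List.mem_toFinset, List.mem_map] at ht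
    obtain ⟨p, -, rfl⟩ := ht
    exact p.2.1
  have hempty : ∀ t, column t (edgeList W.walk) = [] ↔ t ∉ W.xCoords := fun t => by
    rw [← W.column_edgeList_ne_nil_iff, not_not]
  rw [GSAW.displacement, hmin, sub_zero, HasWidth, W.column_edgeList_ne_nil_iff]
  simp only [hempty]
  constructor
  · intro hk
    rw [← hk]
    refine ⟨Finset.max'_mem _ _, fun t ht hmem => ?_⟩
    exact absurd (Finset.le_max' _ _ hmem) (not_le.2 ht)
  · rintro ⟨hk, hlt⟩
    refine le_antisymm (Finset.max'_le _ _ _ fun t ht => ?_) (Finset.le_max' _ _ hk)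
    by_contra! hkt
    exact hlt t hkt ht

/-- The growing self-avoiding walks with `n` edges and displacement `k` correspond to the words of
weight `n` and length `k + 1`. -/
theorem ncard_gsawSet_eq (n k : ℕ) : (gsawSet (stripSet h) (topLeft h hh) n k).ncard =
    (wordsOfWeight (columnLanguage h) letterWeight n (k + 1)).ncard := by
  have hlen : ∀ W : GSAW (stripGraph h) (topLeft h hh), (edgeList W.walk).length = W.length := by
    intro W
    simp [edgeList, GSAW.length]
  have himage : (fun W : GSAW (stripGraph h) (topLeft h hh) => columnWord (edgeList W.walk) k) ''
      gsawSet (stripSet h) (topLeft h hh) n k =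
      wordsOfWeight (columnLanguage h) letterWeight n (k + 1) := by
    ext l
    constructor
    · rintro ⟨W, ⟨hn, hk⟩, rfl⟩
      have hk' := (W.displacement_eq_iff k).1 hk
      refine ⟨⟨_, k, W.isTrappedPath, hk', rfl⟩, by simp [columnWord], ?_⟩
      rw [sum_letterWeight_columnWord W.isTrappedPath hk', hlen, hn]
    · rintro ⟨⟨D, k', hD, hk', rfl⟩, hl, hn⟩
      obtain rfl : k' = k := by simpa [columnWord] using hl
      -- The empty list satisfies `IsTrappedPath` vacuously; the nonempty column required by
      -- `HasWidth` excludes it.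
      have hne : D ≠ [] := by
        rintro rfl
        exact hk'.1 rfl
      obtain ⟨W, rfl⟩ := hD.exists_gsaw (hh := hh) hne
      refine ⟨W, ⟨?_, (W.displacement_eq_iff k').2 hk'⟩, rfl⟩
      rw [← hlen, ← sum_letterWeight_columnWord hD hk', hn]
  rw [← himage, Set.InjOn.ncard_image]
  rintro W ⟨-, hk⟩ W' ⟨-, hk'⟩ hw
  exact GSAW.ext_of_edgeList_eq (columnWord_injective W.isTrappedPath W'.isTrappedPath
    ((W.displacement_eq_iff k).1 hk) ((W'.displacement_eq_iff k).1 hk') hw)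

end Walks

theorem mainTheorem2 (h : ℕ) (hh : 1 ≤ h) : IsRationalSeries (stripSeries h hh) := by
  obtain ⟨T, hT⟩ := exists_alphabet h
  have hseries : stripSeries h hh = fun m => ((wordsOfWeight (columnLanguage h) letterWeight
      (m 0) (m 1 + 1)).ncard : ℚ) :=
    funext fun m => congrArg _ (ncard_gsawSet_eq (m 0) (m 1))
  rw [hseries]
  exact isRationalSeries_of_swapClosed (swapClosed_columnLanguage h) hT letterWeight
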